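/- Let $0<\beta<1$ and $\lambda\ge 0$, and put $\psi_\lambda(s)=(s+\lambda)^\beta-\lambda^\beta$. For a function $g$ of $t>0$ write $\mathcal L[g](s)=\int_0^\infty e^{-st}g(t)\,dt$, and let $$\partial_t^{\beta,\lambda}g(t)=\frac{e^{-\lambda t}}{\Gamma(1-\beta)}\,\frac{d}{dt}J_g(t)-\lambda^\beta g(t),\qquad J_g(t)=\int_0^t\frac{e^{\lambda r}g(r)}{(t-r)^{\beta}}\,dr,$$ be the Riemann–Liouville tempered fractional derivative. Say that $g$ is in its domain if the integral $J_g(t)$ converges absolutely for every $t>0$ and $J_g$, with $J_g(0)=0$, is absolutely continuous on $[0,T]$ for every $T>0$. Let $\phi_\beta(dy)=\frac{\beta}{\Gamma(1-\beta)}y^{-\beta-1}\,dy$ on $(0,\infty)$, so that $\phi_\beta(y,\infty)=y^{-\beta}/\Gamma(1-\beta)$. A driftless subordinator with Lévy measure $\nu$ is a process $(D(x))_{x\ge0}$ with $D(0)=0$ almost surely, stationary independent increments, almost surely nondecreasing right-continuous paths, and $\mathbb E[e^{-sD(x)}]=\exp\left(-x\int_0^\infty(1-e^{-sy})\,\nu(dy)\right)$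 for $s\ge0$, where $\int_0^\infty\min(1,y)\,\nu(dy)<\infty$. The standard stable subordinator $D$ is the one with $\nu=\phi_\beta$. The tempered stable subordinator $D_\lambda$ is the one with $\nu(dy)=e^{-\lambda y}\phi_\beta(dy)$. Say that $q(t,x)$, $t,x>0$, is a mild solution of $$\frac{\partial}{\partial x}q=-\partial_t^{\beta,\lambda}q \qquad (*)$$ if for every $x>0$ the function $q(\cdot,x)$ is in the domain of $\partial_t^{\beta,\lambda}$ and, for all $s>0$, the Laplace integrals at $s$ of $q(\cdot,x)$ and of $\partial_t^{\beta,\lambda}q(\cdot,x)$ converge absolutely, the first is differentiable in $x$, and $$\frac{\partial}{\partial x}\mathcal L[q(\cdot,x)](s)=-\mathcal L[\partial_t^{\beta,\lambda}q(\cdot,x)](s).$$ **Proposition.** 1. The Laplace symbol of $\partial_t^{\beta,\lambda}$ is $\psi_\lambda$: for every $s>0$ and every $g$ in the domain such that the Laplace integrals of $g$ and of $\partial_t^{\beta,\lambda}g$ at $s$ converge absolutely, $\mathcal L[\partial_t^{\beta,\lambda}g](s)=\psi_\lambda(s)\,\mathcal L[g](s)$. 2. For every $x>0$ the random variable $D_\lambda(x)$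 has a density on $(0,\infty)$. If $q_\lambda(\cdot,x)$ is a density of $D_\lambda(x)$ on $(0,\infty)$ for every $x>0$, then $q_\lambda$ is a mild solution of $(*)$. 3. If $f_x$ is a density of $D(x)$ on $(0,\infty)$ for every $x>0$, then $f_x(t)e^{-\lambda t}/e^{-x\lambda^\beta}$ is, as a function of $t$, a density of $D_\lambda(x)$ on $(0,\infty)$ for every $x>0$, and it is a mild solution of $(*)$. -/

import Mathlib

open MeasureTheory ProbabilityTheory Set Filter Topology
open scoped NNReal ENNReal

noncomputable section

/-- The Lévy measure of the standard `β`-stable subordinator, with density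
`β y^(-β-1) / Γ(1-β)` on `(0, ∞)`; its tail is `y^(-β) / Γ(1-β)`
(see `stableLevyMeasure_Ioi`). -/
def stableLevyMeasure (β : ℝ) : Measure ℝ :=
  (volume.restrict (Ioi (0 : ℝ))).withDensity
    (fun y => ENNReal.ofReal (β * y ^ (-β - 1) / Real.Gamma (1 - β)))

/-- The tempered stable Lévy measure `e^(-lam y) φ_β(dy)`. -/
def temperedStableLevyMeasure (β lam : ℝ) : Measure ℝ :=
  (stableLevyMeasure β).withDensity (fun y => ENNReal.ofReal (Real.exp (-lam * y)))

theorem stableLevyMeasure_Ioi {β : ℝ} (h0 : 0 < β) (h1 : β < 1) {y : ℝ} (hy : 0 < y) :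
    stableLevyMeasure β (Ioi y) = ENNReal.ofReal (y ^ (-β) / Real.Gamma (1 - β)) := by
  have hG : 0 < Real.Gamma (1 - β) := Real.Gamma_pos_of_pos (by linarith)
  have hint : IntegrableOn (fun u : ℝ => β * u ^ (-β - 1) / Real.Gamma (1 - β)) (Ioi y) :=
    ((integrableOn_Ioi_rpow_of_lt (by linarith) hy).const_mul β).div_const _
  rw [stableLevyMeasure, withDensity_apply _ measurableSet_Ioi,
    Measure.restrict_restrict measurableSet_Ioi,
    inter_eq_self_of_subset_left (Ioi_subset_Ioi hy.le),
    ← ofReal_integral_eq_lintegral_ofReal hint]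
  · congr 1
    rw [integral_div, integral_const_mul, integral_Ioi_rpow_of_lt (by linarith) hy]
    have : -β - 1 + 1 = -β := by ring
    rw [this]
    field_simp
  · filter_upwards [self_mem_ae_restrict measurableSet_Ioi] with u hu
    have hu' : 0 < u := hy.trans hu
    simp only [Pi.zero_apply]
    positivity

/-- `D` is a (driftless) subordinator with Lévy measure `ν` under the probability measure `P`:
a process started at `0`, with independent and stationary increments and almost surely
nondecreasing right-continuous paths, whose Laplace transform is
`E[exp(-s D(x))] = exp(-x ∫ (1 - exp(-s y)) ν(dy))`. -/
structure IsSubordinator {Ω : Type*} [MeasurableSpace Ω] (D : ℝ≥0 → Ω → ℝ) (P : Measure Ω)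
    (ν : Measure ℝ) : Prop where
  measurable : ∀ x, Measurable (D x)
  zero : ∀ᵐ ω ∂P, D 0 ω = 0
  indep : HasIndepIncrements D P
  stationary : ∀ x h, P.map (fun ω => D (x + h) ω - D x ω) = P.map (D h)
  paths : ∀ᵐ ω ∂P, Monotone (fun x => D x ω) ∧
    ∀ x, ContinuousWithinAt (fun y => D y ω) (Ici x) x
  levy_support : ν (Iic 0) = 0
  levy_integrable : Integrable (fun y => min 1 y) ν
  laplace : ∀ (x : ℝ≥0) (s : ℝ), 0 ≤ s →
    ∫ ω, Real.exp (-s * D x ω) ∂P =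
      Real.exp (-(x : ℝ) * ∫ y, (1 - Real.exp (-s * y)) ∂ν)

/-- `q` is a density on `(0, ∞)` of the measure `μ` on the real line. -/
structure IsDensityOnPos (q : ℝ → ℝ) (μ : Measure ℝ) : Prop where
  measurable : Measurable q
  nonneg : ∀ t, 0 < t → 0 ≤ q t
  eq_withDensity : μ = (volume.restrict (Ioi (0 : ℝ))).withDensity (fun t => ENNReal.ofReal (q t))

/-- The Laplace transform `∫_0^∞ e^(-s t) g(t) dt`. -/
def laplaceTransform (g : ℝ → ℝ) (s : ℝ) : ℝ :=
  ∫ t in Ioi (0 : ℝ), Real.exp (-s * t) * g t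

/-- The Laplace integral of `g` at `s` converges absolutely. -/
def HasLaplaceTransform (g : ℝ → ℝ) (s : ℝ) : Prop :=
  IntegrableOn (fun t => Real.exp (-s * t) * g t) (Ioi (0 : ℝ))

/-- `∫_0^t e^(lam r) g(r) (t - r)^(-β) dr`. -/
def temperedFracIntegral (β lam : ℝ) (g : ℝ → ℝ) (t : ℝ) : ℝ :=
  ∫ r in (0 : ℝ)..t, Real.exp (lam * r) * g r / (t - r) ^ β

/-- The Riemann-Liouville tempered fractional derivative of order `β`. -/
def temperedRLDeriv (β lam : ℝ) (g : ℝ → ℝ) (t : ℝ) : ℝ :=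
  Real.exp (-lam * t) * (1 / Real.Gamma (1 - β)) * deriv (temperedFracIntegral β lam g) t
    - lam ^ β * g t

/-- The functions for which the Riemann-Liouville tempered fractional derivative makes sense:
the fractional integral converges absolutely and is absolutely continuous on every `[0, T]`
(hence differentiable almost everywhere and recovered from its derivative). The integral vanishes
at `0`, so this includes that it tends to `0` at `0+`. -/
def TemperedRLDifferentiable (β lam : ℝ) (g : ℝ → ℝ) : Prop :=
  (∀ t, 0 < t →
    IntervalIntegrable (fun r => Real.exp (lam * r) * g r / (t - r) ^ β) volume 0 t) ∧
  ∀ T, 0 < T → AbsolutelyContinuousOnInterval (temperedFracIntegral β lam g) 0 T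

/-- The Laplace symbol of the tempered stable subordinator. -/
def temperedSymbol (β lam s : ℝ) : ℝ := (s + lam) ^ β - lam ^ β

/-- `ψ` is the Laplace symbol of the tempered fractional derivative: the derivative acts in
transform space as multiplication by `ψ`. -/
def IsLaplaceSymbolOfTemperedRLDeriv (β lam : ℝ) (ψ : ℝ → ℝ) : Prop :=
  ∀ (g : ℝ → ℝ) (s : ℝ), 0 < s → TemperedRLDifferentiable β lam g →
    HasLaplaceTransform g s → HasLaplaceTransform (temperedRLDeriv β lam g) s →
    laplaceTransform (temperedRLDeriv β lam g) s = ψ s * laplaceTransform g s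

/-- `q(t, x)`, `t, x > 0`, is a mild solution of `∂_x q = -∂_t^{β, lam} q`: the Laplace transforms
in `t` of `q(·, x)` and of its tempered fractional derivative exist, and they satisfy the
transformed equation. -/
def IsMildSolution (β lam : ℝ) (q : ℝ → ℝ → ℝ) : Prop :=
  ∀ x, 0 < x →
    TemperedRLDifferentiable β lam (fun t => q t x) ∧
    ∀ s, 0 < s →
      HasLaplaceTransform (fun t => q t x) s ∧
      HasLaplaceTransform (temperedRLDeriv β lam (fun t => q t x)) s ∧
      HasDerivAt (fun x' => laplaceTransform (fun t => q t x') s)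
        (-laplaceTransform (temperedRLDeriv β lam (fun t => q t x)) s) x

/-- The exponentially tilted family `f_x(t) e^(-lam t) / e^(-x lam^β)`. -/
def temperedDensity (β lam : ℝ) (f : ℝ → ℝ → ℝ) (t x : ℝ) : ℝ :=
  f t x * Real.exp (-lam * t) / Real.exp (-x * lam ^ β)

end

/-! Everything is decided by Laplace transforms. Write J_g for the tempered fractional integral.
Weighted by e^(-(s+λ)t), it is the convolution of e^(-sr) g(r) with r^(-β) e^(-(s+λ)r), so
L[J_g](s+λ) = Γ(1-β) (s+λ)^(β-1) L[g](s). Integration by parts supplies one more factor s+λ, and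
this is the symbol ψ (`isLaplaceSymbolOfTemperedRLDeriv`).

The law of D_λ(x) has transform e^(-xψ), whose x-derivative is -ψ e^(-xψ). The mild equation is
therefore immediate once the density p is known to lie in the domain, and that is the main work. The
transform extends holomorphically, with the characteristic function as its boundary value; this
decays like exp(-c|u|^β), so p is C¹ and bounded together with p'
(`exists_density_of_laplace_temperedSymbol`). Differentiating e^(-xψ(s)) in s gives L[t p](s) = xβ
(s+λ)^(β-1) L[p](s), with the same power as in L[J_p]. By uniqueness J_p(t) = Γ(1-β)/(xβ) e^(λt) t
p(t) (`temperedFracIntegral_eq_of_laplace`), which is visibly C¹. Any other density agrees with p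
almost everywhere on the half line and has the same fractional integral.

Tilting by e^(-λt) shifts s to s+λ and turns e^(-x s^β) into e^(-xψ), up to the normalizing
constant; `MeasureTheory.Measure.ext_of_laplace` then identifies the tilted law with that of D_λ(x).
-/

/-! ### Gamma integrals and Lévy exponents -/

theorem integrableOn_rpow_neg_mul_exp {β a : ℝ} (h1 : β < 1) (ha : 0 < a) :
    IntegrableOn (fun t : ℝ => t ^ (-β) * Real.exp (-a * t)) (Ioi 0) := by
  simpa using integrableOn_rpow_mul_exp_neg_mul_rpow (p := 1) (s := -β) (b := a)
    (by linarith) one_pos ha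

theorem integral_rpow_neg_mul_exp {β a : ℝ} (h1 : β < 1) (ha : 0 < a) :
    ∫ t in Ioi (0 : ℝ), t ^ (-β) * Real.exp (-a * t) = Real.Gamma (1 - β) * a ^ (β - 1) := by
  have h := Real.integral_rpow_mul_exp_neg_mul_Ioi (a := 1 - β) (r := a) (by linarith) ha
  rw [show (1 - β - 1 : ℝ) = -β by ring] at h
  simp only [neg_mul]
  rw [h, mul_comm, one_div, Real.inv_rpow ha.le, ← Real.rpow_neg ha.le]
  congr 2
  ring

theorem one_sub_exp_neg_nonneg {x : ℝ} (hx : 0 ≤ x) : 0 ≤ 1 - Real.exp (-x) := by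
  have : Real.exp (-x) ≤ 1 := Real.exp_le_one_iff.2 (by linarith)
  linarith

theorem one_sub_exp_neg_le (x : ℝ) : 1 - Real.exp (-x) ≤ x := by
  have := Real.add_one_le_exp (-x)
  linarith

/-- Near 0 the bound 1 - e^(-ay) ≤ ay leaves y^(-β), integrable since β < 1; beyond 1 the bound by 1
leaves y^(-β-1). -/
theorem integrableOn_one_sub_exp_mul_rpow {β a : ℝ} (h0 : 0 < β) (h1 : β < 1) (ha : 0 < a) :
    IntegrableOn (fun y : ℝ => (1 - Real.exp (-a * y)) * (β * y ^ (-β - 1))) (Ioi 0) := by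
  have hm : ∀ s : Set ℝ, AEStronglyMeasurable
      (fun y : ℝ => (1 - Real.exp (-a * y)) * (β * y ^ (-β - 1))) (volume.restrict s) :=
    fun s => Measurable.aestronglyMeasurable (by fun_prop)
  rw [← Ioc_union_Ioi_eq_Ioi (zero_le_one : (0 : ℝ) ≤ 1)]
  refine IntegrableOn.union ?_ ?_
  · have hi : IntegrableOn (fun y : ℝ => (a * β) * y ^ (-β)) (Ioc 0 1) :=
      ((intervalIntegral.intervalIntegrable_rpow' (a := 0) (b := 1)
        (by linarith : -1 < -β)).1).const_mul _
    refine hi.mono' (hm _) ?_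
    filter_upwards [self_mem_ae_restrict measurableSet_Ioc] with y hy
    have hy0 : 0 < y := hy.1
    have hay : 0 ≤ a * y := by positivity
    have e1 := one_sub_exp_neg_nonneg hay
    have e2 := one_sub_exp_neg_le (a * y)
    rw [neg_mul, Real.norm_of_nonneg (by positivity)]
    have : y ^ (-β) = y * y ^ (-β - 1) := by
      rw [Real.rpow_sub_one hy0.ne']; field_simp
    rw [this]
    calc _ ≤ (a * y) * (β * y ^ (-β - 1)) := by gcongr
      _ = _ := by ring
  · have hi : IntegrableOn (fun y : ℝ => β * y ^ (-β - 1)) (Ioi 1) :=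
      (integrableOn_Ioi_rpow_of_lt (by linarith) one_pos).const_mul _
    refine hi.mono' (hm _) ?_
    filter_upwards [self_mem_ae_restrict measurableSet_Ioi] with y hy
    have hy0 : 0 < y := one_pos.trans hy
    have hay : 0 ≤ a * y := by positivity
    have e1 := one_sub_exp_neg_nonneg hay
    rw [neg_mul, Real.norm_of_nonneg (by positivity)]
    have e3 : 1 - Real.exp (-(a * y)) ≤ 1 := by linarith [Real.exp_pos (-(a * y))]
    calc _ ≤ 1 * (β * y ^ (-β - 1)) := by gcongr
      _ = _ := by ring

/-- Integration by parts with primitive -y^(-β) reduces this to a Gamma integral. The boundary terms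
are at most a y^(1-β) at 0 and y^(-β) at infinity. -/
theorem integral_one_sub_exp_mul_rpow {β a : ℝ} (h0 : 0 < β) (h1 : β < 1) (ha : 0 < a) :
    ∫ y in Ioi (0 : ℝ), (1 - Real.exp (-a * y)) * (β * y ^ (-β - 1)) =
      Real.Gamma (1 - β) * a ^ β := by
  have hu : ∀ y ∈ Ioi (0 : ℝ), HasDerivAt (fun y : ℝ => 1 - Real.exp (-a * y))
      (a * Real.exp (-a * y)) y := fun y _ => by
    have := (((hasDerivAt_id y).const_mul (-a)).exp).const_sub 1
    simpa [mul_comm] using this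
  have hv : ∀ y ∈ Ioi (0 : ℝ), HasDerivAt (fun y : ℝ => -y ^ (-β)) (β * y ^ (-β - 1)) y :=
    fun y hy => by
      have := (Real.hasDerivAt_rpow_const (p := -β) (Or.inl (ne_of_gt hy))).neg
      simpa [Pi.neg_def] using this
  have hz : Tendsto ((fun y : ℝ => 1 - Real.exp (-a * y)) * fun y : ℝ => -y ^ (-β))
      (𝓝[>] 0) (𝓝 0) := by
    have hlim : Tendsto (fun y : ℝ => a * y ^ (1 - β)) (𝓝[>] 0) (𝓝 0) := by
      have h := ((Real.continuousAt_rpow_const 0 (1 - β) (Or.inr (by linarith))).tendsto.const_mul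
        a).mono_left (nhdsWithin_le_nhds (s := Ioi 0))
      rwa [Real.zero_rpow (by linarith), mul_zero] at h
    refine squeeze_zero_norm' ?_ hlim
    filter_upwards [self_mem_nhdsWithin] with y hy
    have hy0 : 0 < y := hy
    have hay : 0 ≤ a * y := by positivity
    have e1 := one_sub_exp_neg_nonneg hay
    have e2 := one_sub_exp_neg_le (a * y)
    simp only [Pi.mul_apply, neg_mul, mul_neg, norm_neg]
    rw [Real.norm_of_nonneg (by positivity)]
    calc _ ≤ (a * y) * y ^ (-β) := by gcongr
      _ = _ := by
        rw [show (1 - β) = -β + 1 by ring, Real.rpow_add_one hy0.ne']; ring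
  have hinf : Tendsto ((fun y : ℝ => 1 - Real.exp (-a * y)) * fun y : ℝ => -y ^ (-β))
      atTop (𝓝 0) := by
    refine squeeze_zero_norm' ?_ (tendsto_rpow_neg_atTop h0)
    filter_upwards [eventually_gt_atTop 0] with y hy0
    have hay : 0 ≤ a * y := by positivity
    have e1 := one_sub_exp_neg_nonneg hay
    simp only [Pi.mul_apply, neg_mul, mul_neg, norm_neg]
    rw [Real.norm_of_nonneg (by positivity)]
    have e3 : 1 - Real.exp (-(a * y)) ≤ 1 := by linarith [Real.exp_pos (-(a * y))]
    calc _ ≤ 1 * y ^ (-β) := by gcongr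
      _ = _ := one_mul _
  have hi : IntegrableOn ((fun y : ℝ => a * Real.exp (-a * y)) * fun y : ℝ => -y ^ (-β))
      (Ioi 0) := by
    refine ((integrableOn_rpow_neg_mul_exp h1 ha).const_mul (-a)).congr (.of_forall fun y => ?_)
    simp only [Pi.mul_apply]; ring
  rw [integral_Ioi_mul_deriv_eq_deriv_mul hu hv (integrableOn_one_sub_exp_mul_rpow h0 h1 ha) hi
    hz hinf]
  have : ∀ y : ℝ, a * Real.exp (-a * y) * -y ^ (-β) = (-a) * (y ^ (-β) * Real.exp (-a * y)) :=
    fun y => by ring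
  simp_rw [this]
  rw [integral_const_mul, integral_rpow_neg_mul_exp h1 ha, Real.rpow_sub_one ha.ne']
  field_simp
  ring

theorem integrable_stableLevyMeasure_iff {β : ℝ} (h0 : 0 < β) (h1 : β < 1) {g : ℝ → ℝ} :
    Integrable g (stableLevyMeasure β) ↔
      IntegrableOn (fun y => g y * (β * y ^ (-β - 1) / Real.Gamma (1 - β))) (Ioi 0) := by
  have hG : 0 < Real.Gamma (1 - β) := Real.Gamma_pos_of_pos (by linarith)
  rw [stableLevyMeasure, integrable_withDensity_iff (by fun_prop)
    (.of_forall fun _ => ENNReal.ofReal_lt_top), IntegrableOn]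
  refine integrable_congr ?_
  filter_upwards [self_mem_ae_restrict measurableSet_Ioi] with y hy
  have hy0 : 0 < y := hy
  rw [ENNReal.toReal_ofReal (by positivity)]

theorem integral_stableLevyMeasure {β : ℝ} (h0 : 0 < β) (h1 : β < 1) (g : ℝ → ℝ) :
    ∫ y, g y ∂stableLevyMeasure β =
      ∫ y in Ioi 0, g y * (β * y ^ (-β - 1) / Real.Gamma (1 - β)) := by
  have hG : 0 < Real.Gamma (1 - β) := Real.Gamma_pos_of_pos (by linarith)
  rw [stableLevyMeasure, integral_withDensity_eq_integral_toReal_smul (by fun_prop)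
    (.of_forall fun _ => ENNReal.ofReal_lt_top)]
  refine integral_congr_ae ?_
  filter_upwards [self_mem_ae_restrict measurableSet_Ioi] with y hy
  have hy0 : 0 < y := hy
  rw [ENNReal.toReal_ofReal (by positivity), smul_eq_mul, mul_comm]

theorem integrable_one_sub_exp_stableLevyMeasure {β a : ℝ} (h0 : 0 < β) (h1 : β < 1)
    (ha : 0 ≤ a) : Integrable (fun y => 1 - Real.exp (-a * y)) (stableLevyMeasure β) := by
  rcases ha.eq_or_lt with rfl | ha
  · simp
  · rw [integrable_stableLevyMeasure_iff h0 h1]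
    simp_rw [← mul_div_assoc]
    exact (integrableOn_one_sub_exp_mul_rpow h0 h1 ha).div_const _

/-- The Lévy exponent of the standard stable subordinator. -/
theorem integral_one_sub_exp_stableLevyMeasure {β a : ℝ} (h0 : 0 < β) (h1 : β < 1)
    (ha : 0 ≤ a) : ∫ y, (1 - Real.exp (-a * y)) ∂stableLevyMeasure β = a ^ β := by
  have hG : 0 < Real.Gamma (1 - β) := Real.Gamma_pos_of_pos (by linarith)
  rcases ha.eq_or_lt with rfl | ha
  · simp [Real.zero_rpow h0.ne']
  · rw [integral_stableLevyMeasure h0 h1]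
    simp_rw [← mul_div_assoc]
    rw [integral_div, integral_one_sub_exp_mul_rpow h0 h1 ha]
    field_simp

/-- The Lévy exponent of the tempered stable subordinator. -/
theorem integral_one_sub_exp_temperedStableLevyMeasure {β lam s : ℝ} (h0 : 0 < β) (h1 : β < 1)
    (hlam : 0 ≤ lam) (hs : 0 ≤ s) :
    ∫ y, (1 - Real.exp (-s * y)) ∂temperedStableLevyMeasure β lam = temperedSymbol β lam s := by
  -- Tempering turns the integrand into a difference of two stable ones: (1 - e^(-sy)) e^(-λy) = (1
  -- - e^(-(s+λ)y)) - (1 - e^(-λy)).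
  rw [temperedStableLevyMeasure, integral_withDensity_eq_integral_toReal_smul (by fun_prop)
    (.of_forall fun _ => ENNReal.ofReal_lt_top), temperedSymbol,
    ← integral_one_sub_exp_stableLevyMeasure h0 h1 hlam,
    ← integral_one_sub_exp_stableLevyMeasure h0 h1 (add_nonneg hs hlam),
    ← integral_sub (integrable_one_sub_exp_stableLevyMeasure h0 h1 (add_nonneg hs hlam))
      (integrable_one_sub_exp_stableLevyMeasure h0 h1 hlam)]
  refine integral_congr_ae (.of_forall fun y => ?_)
  simp only [smul_eq_mul]
  rw [ENNReal.toReal_ofReal (Real.exp_pos _).le, show -(s + lam) * y = -s * y + -lam * y by ring,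
    Real.exp_add]
  ring

/-! ### Laplace transforms determine finite measures on the half line -/

theorem integrable_exp_mul_of_nonpos {μ : Measure ℝ} [IsFiniteMeasure μ] (hμ : μ (Iio 0) = 0)
    {a : ℝ} (ha : a ≤ 0) : Integrable (fun t => Real.exp (a * t)) μ := by
  have h0 : ∀ᵐ t ∂μ, 0 ≤ t := by
    rw [ae_iff]; simpa [Iio_def] using hμ
  refine (integrable_const (1 : ℝ)).mono' (by fun_prop) ?_
  filter_upwards [h0] with t ht
  rw [Real.norm_of_nonneg (Real.exp_pos _).le, Real.exp_le_one_iff]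
  exact mul_nonpos_of_nonpos_of_nonneg ha ht

theorem complexMGF_differentiableOn_of_nonneg {μ : Measure ℝ} [IsFiniteMeasure μ]
    (hμ : μ (Iio 0) = 0) : DifferentiableOn ℂ (complexMGF id μ) {z | z.re < 0} := by
  have hset : {z : ℂ | z.re < 0} ⊆ {z | z.re ∈ interior (integrableExpSet id μ)} := by
    intro z hz
    refine mem_interior.2 ⟨Iio 0, fun a ha => ?_, isOpen_Iio, hz⟩
    exact integrable_exp_mul_of_nonpos hμ (le_of_lt ha)
  exact differentiableOn_complexMGF.mono hset

theorem complexMGF_continuousOn_of_nonneg {μ : Measure ℝ} [IsFiniteMeasure μ]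
    (hμ : μ (Iio 0) = 0) : ContinuousOn (complexMGF id μ) {z | z.re ≤ 0} := by
  have h0 : ∀ᵐ t ∂μ, 0 ≤ t := by
    rw [ae_iff]; simpa [Iio_def] using hμ
  unfold complexMGF
  refine continuousOn_of_dominated (bound := fun _ => 1) (fun z _ => by fun_prop)
    (fun z hz => ?_) (integrable_const _) (.of_forall fun t => by fun_prop)
  filter_upwards [h0] with t ht
  rw [Complex.norm_exp]
  simp only [id_eq, Complex.mul_re, Complex.ofReal_re, Complex.ofReal_im, mul_zero, sub_zero,
    Real.exp_le_one_iff]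
  exact mul_nonpos_of_nonpos_of_nonneg hz ht

/-- If the Laplace transform of a finite measure on `[0, ∞)` extends to a function `G` that is
holomorphic on the left half plane and continuous up to the boundary, then the characteristic
function is the boundary value of `G`. -/
theorem charFun_eq_of_laplace_eq {μ : Measure ℝ} [IsFiniteMeasure μ] (hμ : μ (Iio 0) = 0)
    {G : ℂ → ℂ} (hG : DifferentiableOn ℂ G {z | z.re < 0}) (hGc : ContinuousOn G {z | z.re ≤ 0})
    (h : ∀ s : ℝ, 0 < s → ((∫ t, Real.exp (-s * t) ∂μ : ℝ) : ℂ) = G (-s)) (u : ℝ) :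
    charFun μ u = G (u * Complex.I) := by
  have hopen : IsOpen {z : ℂ | z.re < 0} := isOpen_lt Complex.continuous_re continuous_const
  have hMa : AnalyticOnNhd ℂ (complexMGF id μ) {z | z.re < 0} :=
    (complexMGF_differentiableOn_of_nonneg hμ).analyticOnNhd hopen
  have hreal : ∀ s : ℝ, 0 < s → complexMGF id μ (-s : ℂ) = G (-s) := by
    intro s hs
    rw [← h s hs, ← Complex.ofReal_neg, complexMGF_ofReal]
    rfl
  have hpre : IsPreconnected {z : ℂ | z.re < 0} := (convex_halfSpace_re_lt 0).isPreconnected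
  -- Identity theorem: the two functions agree on the negative real axis, which accumulates at -1.
  have heq : EqOn (complexMGF id μ) G {z : ℂ | z.re < 0} := by
    refine hMa.eqOn_of_preconnected_of_frequently_eq (hG.analyticOnNhd hopen) hpre
      (z₀ := -1) (by simp) ?_
    have ht : Tendsto (fun s : ℝ => (-s : ℂ)) (𝓝[≠] 1) (𝓝[≠] (-1)) := by
      refine tendsto_nhdsWithin_iff.2 ⟨?_, ?_⟩
      · have : Continuous (fun s : ℝ => (-s : ℂ)) := by fun_prop
        simpa using (this.tendsto 1).mono_left nhdsWithin_le_nhds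
      · filter_upwards [self_mem_nhdsWithin] with s hs
        simpa [neg_inj] using hs
    refine ht.frequently (Eventually.frequently ?_)
    filter_upwards [nhdsWithin_le_nhds (lt_mem_nhds (zero_lt_one : (0 : ℝ) < 1))] with s hs
    exact hreal s hs
  -- Continuity carries the equality to the imaginary axis, where the moment generating function is
  -- the characteristic function.
  have hcl := heq.of_subset_closure (complexMGF_continuousOn_of_nonneg hμ) hGc
    (fun z (hz : z.re < 0) => hz.le) (by rw [Complex.closure_setOfPred_re_lt])
  rw [← complexMGF_id_mul_I]
  exact hcl (by simp)

/-- A finite measure on `[0, ∞)` is determined by its Laplace transform. -/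
theorem MeasureTheory.Measure.ext_of_laplace {μ ν : Measure ℝ} [IsFiniteMeasure μ]
    [IsFiniteMeasure ν] (hμ : μ (Iio 0) = 0) (hν : ν (Iio 0) = 0)
    (h : ∀ s : ℝ, 0 < s → ∫ t, Real.exp (-s * t) ∂μ = ∫ t, Real.exp (-s * t) ∂ν) : μ = ν := by
  refine Measure.ext_of_charFun (funext fun u => ?_)
  rw [charFun_eq_of_laplace_eq hμ (complexMGF_differentiableOn_of_nonneg hν)
    (complexMGF_continuousOn_of_nonneg hν), complexMGF_id_mul_I]
  intro s hs
  rw [← Complex.ofReal_neg, complexMGF_ofReal, h s hs]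
  rfl

/-! ### Smooth densities by Fourier inversion -/

-- Fubini is applied twice, to the pairing of 𝓕F with μ and of F with Lebesgue measure. Both equal
-- the integral of 𝓕F against the characteristic function; the form `-innerₗ` turns the first
-- transform into Fourier inversion.
open scoped FourierTransform ContDiff in
theorem integral_schwartzMap_eq_of_integrable_charFun {μ : Measure ℝ} [IsFiniteMeasure μ]
    (h : Integrable (charFun μ)) (F : SchwartzMap ℝ ℂ) :
    ∫ t, F t ∂μ = ∫ t, F t * 𝓕 (fun w => charFun μ (2 * Real.pi * w)) t := by
  have hψ : Integrable (fun w => charFun μ (2 * Real.pi * w)) :=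
    h.comp_mul_left' (by positivity)
  -- Every bilinear form on the line is a multiple of the product, so it is jointly continuous.
  have hc : ∀ L : ℝ →ₗ[ℝ] ℝ →ₗ[ℝ] ℝ, Continuous fun p : ℝ × ℝ => L p.1 p.2 := fun L => by
    have : (fun p : ℝ × ℝ => L p.1 p.2) = fun p => p.1 * p.2 * L 1 1 := by
      ext p
      have h1 : L p.1 = p.1 • L 1 := by rw [← map_smul]; simp
      have h2 : L 1 p.2 = p.2 • L 1 1 := by rw [← map_smul]; simp
      rw [h1, LinearMap.smul_apply, h2]
      simp [mul_assoc]
    rw [this]; fun_prop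
  have h1 := VectorFourier.integral_fourierIntegral_smul_eq_flip (μ := volume) (ν := μ)
    (L := -innerₗ ℝ) (f := (𝓕 F : SchwartzMap ℝ ℂ)) (g := fun _ => (1 : ℂ))
    Real.continuous_fourierChar (hc _) (SchwartzMap.integrable _) (integrable_const _)
  have h2 := VectorFourier.integral_fourierIntegral_smul_eq_flip (μ := volume) (ν := volume)
    (L := innerₗ ℝ) (f := F) (g := fun w => charFun μ (2 * Real.pi * w))
    Real.continuous_fourierChar (hc _) (SchwartzMap.integrable _) hψ
  have e1 : ∀ t, VectorFourier.fourierIntegral Real.fourierChar volume (-innerₗ ℝ)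
      (𝓕 F : SchwartzMap ℝ ℂ) t = F t := fun t => by
    change 𝓕⁻ ((𝓕 F : SchwartzMap ℝ ℂ) : ℝ → ℂ) t = F t
    rw [← SchwartzMap.fourierInv_coe]; simp
  have e2 : ∀ w, VectorFourier.fourierIntegral Real.fourierChar μ (-innerₗ ℝ).flip
      (fun _ => (1 : ℂ)) w = charFun μ (2 * Real.pi * w) := fun w => by
    rw [VectorFourier.fourierIntegral, charFun_apply_real]
    refine integral_congr_ae (.of_forall fun t => ?_)
    simp [Circle.smul_def, Real.fourierChar_apply]
    congr 1; ring
  have e3 : ∀ w, VectorFourier.fourierIntegral Real.fourierChar volume (innerₗ ℝ) F w =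
      (𝓕 F : SchwartzMap ℝ ℂ) w := fun w => by
    rw [SchwartzMap.fourier_coe]; rfl
  simp only [e1, e2, smul_eq_mul, mul_one] at h1
  simp only [e3, smul_eq_mul, flip_innerₗ] at h2
  rw [h1, h2]
  rfl

-- By inner regularity only null compact sets K matter. A smooth bump equal to 1 on K and supported
-- in a set of measure below ε gives μ(K) ≤ ∫ g dμ = ∫ g p ≤ Cε.
open scoped ContDiff in
theorem absolutelyContinuous_of_integral_contDiff_eq {μ : Measure ℝ} [IsFiniteMeasure μ]
    {p : ℝ → ℝ} {C : ℝ} (hp : ∀ t, |p t| ≤ C)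
    (h : ∀ g : ℝ → ℝ, ContDiff ℝ ∞ g → HasCompactSupport g → ∫ t, g t ∂μ = ∫ t, g t * p t) :
    μ ≪ volume := by
  have hC : 0 ≤ C := (abs_nonneg _).trans (hp 0)
  have key : ∀ K : Set ℝ, IsCompact K → volume K = 0 → μ K = 0 := by
    intro K hK hK0
    by_contra hne
    have hpos : 0 < μ.real K := ENNReal.toReal_pos hne (measure_ne_top _ _)
    obtain ⟨ε, hε, hεC⟩ : ∃ ε : ℝ, 0 < ε ∧ C * ε < μ.real K :=
      ⟨μ.real K / (C + 1), by positivity, by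
        rw [← mul_div_assoc, div_lt_iff₀ (by positivity)]; nlinarith⟩
    obtain ⟨U, hKU, hU, hUε⟩ := K.exists_isOpen_lt_of_lt (μ := volume) (ENNReal.ofReal ε)
      (by rw [hK0]; simpa using hε)
    obtain ⟨V, hV, hKV, hVU, hVc⟩ := exists_open_between_and_isCompact_closure hK hU hKU
    obtain ⟨g, hg, hgr, hgs, hg1⟩ := exists_contMDiff_support_eq_eq_one_iff (n := ⊤)
      (modelWithCornersSelf ℝ ℝ) hV hK.isClosed hKV
    have hgc : HasCompactSupport g :=
      HasCompactSupport.of_support_subset_isCompact hVc (hgs ▸ subset_closure)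
    have hg' : ContDiff ℝ ∞ g := hg.contDiff
    have hg01 : ∀ t, 0 ≤ g t ∧ g t ≤ 1 := fun t => hgr (mem_range_self t)
    have hVε : volume V < ENNReal.ofReal ε :=
      (measure_mono (subset_closure.trans hVU)).trans_lt hUε
    have hle1 : μ.real K ≤ ∫ t, g t ∂μ := by
      rw [← integral_indicator_one hK.measurableSet]
      refine integral_mono ((integrable_const _).indicator hK.measurableSet)
        (hg'.continuous.integrable_of_hasCompactSupport hgc) fun t => ?_
      by_cases ht : t ∈ K
      · simp [ht, (hg1 t).1 ht]
      · simpa [ht] using (hg01 t).1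
    have hle2 : ∫ t, g t * p t ≤ C * volume.real V := by
      have : ∫ t, g t * p t = ∫ t in V, g t * p t := by
        refine (setIntegral_eq_integral_of_forall_compl_eq_zero fun t ht => ?_).symm
        rw [← hgs, Function.notMem_support] at ht
        simp [ht]
      rw [this]
      refine (Real.le_norm_self _).trans (norm_setIntegral_le_of_norm_le_const
        (hVε.trans ENNReal.ofReal_lt_top) fun t _ => ?_)
      rw [norm_mul, Real.norm_of_nonneg (hg01 t).1]
      calc _ ≤ 1 * C := mul_le_mul (hg01 t).2 (hp t) (abs_nonneg _) zero_le_one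
        _ = C := one_mul C
    have hle3 : volume.real V ≤ ε := ENNReal.toReal_le_of_le_ofReal hε.le hVε.le
    have := h g hg' hgc
    nlinarith
  refine Measure.AbsolutelyContinuous.mk fun s hs hs0 => ?_
  rw [hs.measure_eq_iSup_isCompact]
  simp only [ENNReal.iSup_eq_zero]
  exact fun K hKs hK => key K hK (measure_mono_null hKs hs0)

open scoped FourierTransform ContDiff in
/-- A finite measure on the line whose characteristic function is integrable against `1 + |u|`
has a bounded continuously differentiable density with bounded derivative. -/
theorem exists_density_of_integrable_charFun {μ : Measure ℝ} [IsFiniteMeasure μ]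
    (h0 : Integrable (charFun μ)) (h1 : Integrable fun u : ℝ => u • charFun μ u) :
    ∃ (p p' : ℝ → ℝ) (C : ℝ), (∀ t, HasDerivAt p (p' t) t) ∧ Continuous p' ∧ (∀ t, 0 ≤ p t) ∧
      (∀ t, |p t| ≤ C) ∧ (∀ t, |p' t| ≤ C) ∧
      μ = volume.withDensity (fun t => ENNReal.ofReal (p t)) := by
  set ψ : ℝ → ℂ := fun w => charFun μ (2 * Real.pi * w) with hψdef
  have hψ : Integrable ψ := h0.comp_mul_left' (by positivity)
  have hψ1 : Integrable fun w : ℝ => w • ψ w := by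
    have := (h1.comp_mul_left' (R := 2 * Real.pi) (by positivity)).smul ((2 * Real.pi)⁻¹)
    refine this.congr (.of_forall fun w => ?_)
    simp only [Pi.smul_apply, smul_smul, hψdef]
    congr 1
    field_simp
  -- Differentiating 𝓕ψ under the integral sign multiplies ψ by -2πiw.
  set ψ' : ℝ → ℂ := fun w => (-2 * Real.pi * Complex.I * w) • ψ w with hψ'def
  have hψ' : Integrable ψ' := by
    refine (hψ1.const_mul (-2 * Real.pi * Complex.I)).congr (.of_forall fun w => ?_)
    simp only [hψ'def, smul_eq_mul, Complex.real_smul]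
    ring
  have hcont : ∀ f : ℝ → ℂ, Integrable f → Continuous (𝓕 f) := fun f hf =>
    VectorFourier.fourierIntegral_continuous Real.continuous_fourierChar
      (by simp only [innerₗ_apply_apply]; fun_prop) hf
  have hbd : ∀ (f : ℝ → ℂ) (t : ℝ), |(𝓕 f t).re| ≤ ∫ w, ‖f w‖ := fun f t =>
    (Complex.abs_re_le_norm _).trans (VectorFourier.norm_fourierIntegral_le_integral_norm _ _ _ _ _)
  set p : ℝ → ℝ := fun t => (𝓕 ψ t).re with hpdef
  have hpc : Continuous p := Complex.continuous_re.comp (hcont ψ hψ)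
  have hint : ∀ g : ℝ → ℝ, ContDiff ℝ ∞ g → HasCompactSupport g →
      ∫ t, g t ∂μ = ∫ t, g t * p t := by
    intro g hg hgc
    have hgc' : HasCompactSupport fun t => (g t : ℂ) := hgc.comp_left Complex.ofReal_zero
    have hg' : ContDiff ℝ ∞ fun t => (g t : ℂ) := Complex.ofRealCLM.contDiff.comp hg
    have := integral_schwartzMap_eq_of_integrable_charFun h0 (hgc'.toSchwartzMap hg')
    change ∫ t, (g t : ℂ) ∂μ = ∫ t, (g t : ℂ) * 𝓕 ψ t at this
    rw [integral_complex_ofReal] at this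
    have h2 := congrArg Complex.re this
    rw [Complex.ofReal_re] at h2
    rw [h2]
    have hi : Integrable fun t => (g t : ℂ) * 𝓕 ψ t :=
      (hg'.continuous.mul (hcont ψ hψ)).integrable_of_hasCompactSupport hgc'.mul_right
    rw [← RCLike.re_eq_complex_re, ← integral_re hi]
    simp [hpdef]
  have hac : μ ≪ volume := absolutelyContinuous_of_integral_contDiff_eq (hbd ψ) hint
  have hae : ∀ᵐ t, (μ.rnDeriv volume t).toReal = p t := by
    refine ae_eq_of_integral_contDiff_smul_eq Measure.integrable_toReal_rnDeriv.locallyIntegrable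
      hpc.locallyIntegrable fun g hg hgc => ?_
    simp only [smul_eq_mul]
    rw [← hint g hg hgc, ← integral_rnDeriv_smul hac]
    simp only [smul_eq_mul, mul_comm]
  -- Nonnegativity holds almost everywhere through the Radon–Nikodym derivative, and everywhere by
  -- continuity.
  have hpos : ∀ t, 0 ≤ p t := by
    have : (fun t => max (p t) 0) =ᵐ[volume] p := by
      filter_upwards [hae] with t ht
      rw [← ht, max_eq_left ENNReal.toReal_nonneg]
    have := (Continuous.ae_eq_iff_eq volume (by fun_prop) hpc).1 this
    intro t
    rw [← congrFun this t]
    exact le_max_right _ _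
  refine ⟨p, fun t => (𝓕 ψ' t).re, max (∫ w, ‖ψ w‖) (∫ w, ‖ψ' w‖), fun t => ?_,
    Complex.continuous_re.comp (hcont ψ' hψ'), hpos, fun t => (hbd ψ t).trans (le_max_left _ _),
    fun t => (hbd ψ' t).trans (le_max_right _ _), ?_⟩
  · exact (Complex.reCLM.hasFDerivAt.comp_hasDerivAt t (Real.hasDerivAt_fourier hψ hψ1 t))
  · conv_lhs => rw [← Measure.withDensity_rnDeriv_eq μ volume hac]
    refine withDensity_congr_ae ?_
    filter_upwards [hae, μ.rnDeriv_lt_top volume] with t ht ht'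
    rw [← ht, ENNReal.ofReal_toReal ht'.ne]

/-! ### Decay of the characteristic function of the tempered stable law -/

/-- Re z^β = |z|^β cos(β arg z), and |arg z| ≤ π/2 in the right half plane. Applied to z = λ - iu,
this gives the decay of the characteristic function. -/
theorem rpow_mul_cos_le_re_cpow {z : ℂ} {β : ℝ} (hz : 0 ≤ z.re) (h0 : 0 ≤ β) (h1 : β ≤ 1) :
    |z.im| ^ β * Real.cos (Real.pi / 2 * β) ≤ (z ^ (β : ℂ)).re := by
  rw [Complex.cpow_ofReal_re]
  have ha : |z.arg| ≤ Real.pi / 2 := Complex.abs_arg_le_pi_div_two_iff.2 hz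
  have hπ := Real.pi_pos
  have hcos : Real.cos (Real.pi / 2 * β) ≤ Real.cos (z.arg * β) := by
    rw [← Real.cos_abs (z.arg * β), abs_mul, abs_of_nonneg h0]
    refine Real.cos_le_cos_of_nonneg_of_le_pi (by positivity) ?_ (by gcongr)
    nlinarith
  have hnn : 0 ≤ Real.cos (Real.pi / 2 * β) :=
    Real.cos_nonneg_of_mem_Icc ⟨by nlinarith, by nlinarith⟩
  gcongr
  exact Complex.abs_im_le_norm z

theorem integrable_comp_abs {f : ℝ → ℝ} (hf : IntegrableOn f (Ioi 0)) :
    Integrable fun u => f |u| := by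
  have hpos : IntegrableOn (fun u => f |u|) (Ioi 0) :=
    hf.congr_fun (fun u hu => by simp only [abs_of_pos (mem_Ioi.1 hu)]) measurableSet_Ioi
  rw [← integrableOn_univ, ← Iic_union_Ioi (a := (0 : ℝ)), integrableOn_union,
    integrableOn_Iic_iff_integrableOn_Iio]
  refine ⟨?_, hpos⟩
  have h := IntegrableOn.comp_neg_Iio (c := (0 : ℝ)) (f := fun u => f |u|) (by simpa using hpos)
  simpa using h

theorem integrable_abs_rpow_mul_exp_neg {β c k : ℝ} (h0 : 0 < β) (hc : 0 < c) (hk : -1 < k) :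
    Integrable fun u : ℝ => |u| ^ k * Real.exp (-c * |u| ^ β) :=
  integrable_comp_abs (integrableOn_rpow_mul_exp_neg_mul_rpow hk h0 hc)

section TemperedLaw

variable {μ : Measure ℝ} [IsFiniteMeasure μ] {β lam x : ℝ}

theorem charFun_of_laplace_temperedSymbol (hμ : μ (Iio 0) = 0) (h0 : 0 < β)
    (hlam : 0 ≤ lam)
    (hL : ∀ s, 0 < s → ∫ t, Real.exp (-s * t) ∂μ = Real.exp (-x * temperedSymbol β lam s))
    (u : ℝ) : charFun μ u =
      Complex.exp (-x * ((lam - u * Complex.I) ^ (β : ℂ) - (lam ^ β : ℝ))) := by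
  refine charFun_eq_of_laplace_eq hμ
    (G := fun z => Complex.exp (-x * ((lam - z) ^ (β : ℂ) - (lam ^ β : ℝ)))) ?_ ?_ ?_ u
  · intro z hz
    have hz' : z.re < 0 := hz
    have : (lam : ℂ) - z ∈ Complex.slitPlane := Or.inl (by simp; linarith)
    refine DifferentiableAt.differentiableWithinAt ?_
    refine DifferentiableAt.cexp (DifferentiableAt.const_mul (DifferentiableAt.sub_const ?_ _) _)
    exact (differentiableAt_id.const_sub _).cpow_const this
  · intro z hz
    have hz' : z.re ≤ 0 := hz
    refine ContinuousAt.continuousWithinAt ?_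
    -- For λ = 0 the boundary contains the branch point z = 0; the power is still continuous there
    -- because β > 0.
    have h1 : ContinuousAt (fun y : ℂ => y ^ (β : ℂ)) (lam - z) :=
      ContinuousAt.comp (f := fun y : ℂ => (y, (β : ℂ))) (g := fun q : ℂ × ℂ => q.1 ^ q.2)
        (Complex.continuousAt_cpow_of_re_pos (Or.inl (by simp; linarith)) (by simpa using h0))
        (by fun_prop)
    have h2 : ContinuousAt (fun y : ℂ => ((lam : ℂ) - y) ^ (β : ℂ)) z :=
      ContinuousAt.comp (f := fun y : ℂ => (lam : ℂ) - y) h1 (by fun_prop)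
    exact ((h2.sub continuousAt_const).const_mul _).cexp
  · intro s hs
    rw [hL s hs, temperedSymbol, Complex.ofReal_exp]
    congr 1
    rw [sub_neg_eq_add, add_comm (lam : ℂ)]
    push_cast
    rw [Complex.ofReal_cpow (add_nonneg hs.le hlam)]
    push_cast
    rfl

/-- A law on `[0, ∞)` with the Laplace transform of the tempered stable subordinator at time `x`
has a density on the line that is `C¹`, bounded with bounded derivative, and supported on the
positive half line. -/
theorem exists_density_of_laplace_temperedSymbol (hμ : μ (Iio 0) = 0) (h0 : 0 < β) (h1 : β < 1)
    (hlam : 0 ≤ lam) (hx : 0 < x)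
    (hL : ∀ s, 0 < s → ∫ t, Real.exp (-s * t) ∂μ = Real.exp (-x * temperedSymbol β lam s)) :
    ∃ (p p' : ℝ → ℝ) (C : ℝ), (∀ t, HasDerivAt p (p' t) t) ∧ Continuous p' ∧ (∀ t, 0 ≤ p t) ∧
      (∀ t, |p t| ≤ C) ∧ (∀ t, |p' t| ≤ C) ∧ (∀ t ≤ 0, p t = 0) ∧
      μ = volume.withDensity (fun t => ENNReal.ofReal (p t)) := by
  have hπ := Real.pi_pos
  set c : ℝ := x * Real.cos (Real.pi / 2 * β) with hcdef
  have hc : 0 < c := mul_pos hx (Real.cos_pos_of_mem_Ioo ⟨by nlinarith, by nlinarith⟩)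
  have hbd : ∀ u : ℝ, ‖charFun μ u‖ ≤ Real.exp (x * lam ^ β) * Real.exp (-c * |u| ^ β) := by
    intro u
    rw [charFun_of_laplace_temperedSymbol hμ h0 hlam hL, Complex.norm_exp, ← Real.exp_add,
      Real.exp_le_exp]
    have := rpow_mul_cos_le_re_cpow (z := lam - u * Complex.I) (by simpa using hlam) h0.le h1.le
    have him : |((lam : ℂ) - u * Complex.I).im| = |u| := by simp
    rw [him] at this
    rw [← Complex.ofReal_neg, Complex.re_ofReal_mul, Complex.sub_re, Complex.ofReal_re]
    nlinarith
  have hi0 : Integrable (charFun μ) := by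
    have := (integrable_abs_rpow_mul_exp_neg (k := 0) h0 hc (by norm_num)).const_mul
      (Real.exp (x * lam ^ β))
    refine this.mono' continuous_charFun.aestronglyMeasurable (.of_forall fun u => ?_)
    simpa using hbd u
  have hi1 : Integrable fun u : ℝ => u • charFun μ u := by
    have := (integrable_abs_rpow_mul_exp_neg (k := 1) h0 hc (by norm_num)).const_mul
      (Real.exp (x * lam ^ β))
    refine this.mono' (continuous_id.smul continuous_charFun).aestronglyMeasurable
      (.of_forall fun u => ?_)
    rw [norm_smul, Real.norm_eq_abs, Real.rpow_one]
    calc _ ≤ |u| * (Real.exp (x * lam ^ β) * Real.exp (-c * |u| ^ β)) := by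
          gcongr; exact hbd u
      _ = _ := by ring
  obtain ⟨p, p', C, hd, hc', hp0, hpC, hpC', hpμ⟩ := exists_density_of_integrable_charFun hi0 hi1
  have hpc : Continuous p := continuous_iff_continuousAt.2 fun t => (hd t).continuousAt
  refine ⟨p, p', C, hd, hc', hp0, hpC, hpC', ?_, hpμ⟩
  -- The set of negative t with p(t) > 0 is open and null, hence empty.
  have hneg : ∀ t ∈ Iio (0 : ℝ), p t = 0 := by
    rw [hpμ, withDensity_apply_eq_zero (by fun_prop)] at hμ
    have ho : IsOpen ({t | ENNReal.ofReal (p t) ≠ 0} ∩ Iio 0) :=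
      (isOpen_ne_fun (ENNReal.continuous_ofReal.comp hpc) continuous_const).inter isOpen_Iio
    intro t ht
    have := (ho.measure_eq_zero_iff volume).1 hμ
    by_contra hne
    have hmem : t ∈ ({t | ENNReal.ofReal (p t) ≠ 0} ∩ Iio 0) :=
      ⟨by simpa using lt_of_le_of_ne (hp0 t) (Ne.symm hne), ht⟩
    rw [this] at hmem
    exact hmem
  intro t ht
  have hcl : IsClosed {t | p t = 0} := isClosed_eq hpc continuous_const
  exact hcl.closure_subset_iff.2 hneg (by rwa [closure_Iio])

end TemperedLaw

/-! ### The Laplace symbol of the tempered derivative -/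

section FractionalIntegral

variable {β lam s : ℝ} {g : ℝ → ℝ}

/-- Splitting the exponential weight between r and t - r makes both convolution factors integrable
on the half line. -/
theorem posConvolution_exp_mul_eq {t : ℝ} (ht : 0 < t) :
    ∫ r in (0 : ℝ)..t, ContinuousLinearMap.mul ℝ ℝ (Real.exp (-s * r) * g r)
        ((t - r) ^ (-β) * Real.exp (-(s + lam) * (t - r))) =
      Real.exp (-(s + lam) * t) * temperedFracIntegral β lam g t := by
  rw [temperedFracIntegral, ← intervalIntegral.integral_const_mul]
  refine intervalIntegral.integral_congr fun r hr => ?_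
  rw [uIcc_of_le ht.le] at hr
  simp only [ContinuousLinearMap.mul_apply']
  rw [Real.rpow_neg (sub_nonneg.2 hr.2), div_eq_mul_inv,
    show -(s + lam) * (t - r) = -(s + lam) * t + (s + lam) * r by ring, Real.exp_add,
    show Real.exp (lam * r) = Real.exp (-s * r) * Real.exp ((s + lam) * r) by
      rw [← Real.exp_add]; ring_nf]
  ring

/-- The tempered fractional integral has an absolutely convergent Laplace transform. -/
theorem hasLaplaceTransform_temperedFracIntegral (h1 : β < 1) (ha : 0 < s + lam)
    (hg : HasLaplaceTransform g s) :
    HasLaplaceTransform (temperedFracIntegral β lam g) (s + lam) := by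
  have h := integrable_posConvolution hg (integrableOn_rpow_neg_mul_exp h1 ha)
    (ContinuousLinearMap.mul ℝ ℝ)
  refine (h.integrableOn (s := Ioi 0)).congr_fun (fun t ht => ?_) measurableSet_Ioi
  rw [posConvolution, indicator_of_mem ht, posConvolution_exp_mul_eq ht]

theorem laplaceTransform_temperedFracIntegral (h1 : β < 1) (ha : 0 < s + lam)
    (hg : HasLaplaceTransform g s) :
    laplaceTransform (temperedFracIntegral β lam g) (s + lam) =
      Real.Gamma (1 - β) * (s + lam) ^ (β - 1) * laplaceTransform g s := by
  have h := integral_posConvolution hg (integrableOn_rpow_neg_mul_exp h1 ha)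
    (ContinuousLinearMap.mul ℝ ℝ)
  rw [integral_rpow_neg_mul_exp h1 ha, ContinuousLinearMap.mul_apply'] at h
  rw [mul_comm _ (laplaceTransform g s)]
  refine Eq.trans ?_ h
  exact setIntegral_congr_fun measurableSet_Ioi fun t ht => (posConvolution_exp_mul_eq ht).symm

/-- The Laplace transform of the derivative of a locally absolutely continuous function that
vanishes at the origin. -/
theorem laplaceTransform_deriv_of_absolutelyContinuous {F : ℝ → ℝ} {a : ℝ}
    (hF : ∀ T, 0 < T → AbsolutelyContinuousOnInterval F 0 T) (hF0 : F 0 = 0)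
    (hL : HasLaplaceTransform F a) (hL' : HasLaplaceTransform (deriv F) a) :
    laplaceTransform (deriv F) a = a * laplaceTransform F a := by
  have hE : ∀ t, deriv (fun t => Real.exp (-a * t)) t = -a * Real.exp (-a * t) := fun t => by
    have := (((hasDerivAt_id t).const_mul (-a)).exp).deriv
    simpa [mul_comm] using this
  have hparts : ∀ T, 0 < T → Real.exp (-a * T) * F T =
      (∫ t in (0 : ℝ)..T, Real.exp (-a * t) * deriv F t) -
        a * ∫ t in (0 : ℝ)..T, Real.exp (-a * t) * F t := by
    intro T hT
    have hEac : AbsolutelyContinuousOnInterval (fun t => Real.exp (-a * t)) 0 T :=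
      ContDiffOn.absolutelyContinuousOnInterval (by fun_prop)
    have h := hEac.integral_mul_deriv_eq_deriv_mul (hF T hT)
    simp only [hE, hF0, mul_zero, sub_zero, mul_assoc, intervalIntegral.integral_const_mul] at h
    linarith
  have hlim : Tendsto (fun T => Real.exp (-a * T) * F T) atTop
      (𝓝 (laplaceTransform (deriv F) a - a * laplaceTransform F a)) := by
    have h := (intervalIntegral_tendsto_integral_Ioi 0 hL' tendsto_id).sub
      ((intervalIntegral_tendsto_integral_Ioi 0 hL tendsto_id).const_mul a)
    refine h.congr' ?_
    filter_upwards [eventually_gt_atTop 0] with T hT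
    exact (hparts T hT).symm
  have hat : IntegrableAtFilter (fun T => Real.exp (-a * T) * F T) atTop :=
    ⟨Ioi 0, Ioi_mem_atTop 0, hL⟩
  -- The boundary term at infinity is integrable and has a limit, so the limit is 0; no growth bound
  -- on F is required.
  have h0 := hat.eq_zero_of_tendsto (fun u hu => by
    obtain ⟨b, hb⟩ := mem_atTop_sets.1 hu
    rw [← top_le_iff, ← Real.volume_Ici (a := b)]
    exact measure_mono hb) hlim
  linarith

/-- The Laplace symbol of the tempered Riemann-Liouville derivative. -/
theorem isLaplaceSymbolOfTemperedRLDeriv (h1 : β < 1) (hlam : 0 ≤ lam) :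
    IsLaplaceSymbolOfTemperedRLDeriv β lam (temperedSymbol β lam) := by
  intro g s hs hg hgL hdL
  have ha : 0 < s + lam := by linarith
  have hG : 0 < Real.Gamma (1 - β) := Real.Gamma_pos_of_pos (by linarith)
  set J := temperedFracIntegral β lam g with hJ
  have hexp : ∀ t, Real.exp (-s * t) * Real.exp (-lam * t) = Real.exp (-(s + lam) * t) :=
    fun t => by rw [← Real.exp_add]; ring_nf
  have hpt : ∀ t, Real.exp (-s * t) * temperedRLDeriv β lam g t =
      (Real.Gamma (1 - β))⁻¹ * (Real.exp (-(s + lam) * t) * deriv J t) -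
        lam ^ β * (Real.exp (-s * t) * g t) := fun t => by
    rw [temperedRLDeriv, ← hexp]; ring
  have hJ' : HasLaplaceTransform (deriv J) (s + lam) := by
    refine ((hdL.add (hgL.const_mul (lam ^ β))).const_mul (Real.Gamma (1 - β))).congr
      (.of_forall fun t => ?_)
    simp only [Pi.add_apply, hpt]
    field_simp
    ring
  have hJL := laplaceTransform_deriv_of_absolutelyContinuous hg.2
    (by simp [temperedFracIntegral]) (hasLaplaceTransform_temperedFracIntegral h1 ha hgL) hJ'
  rw [laplaceTransform_temperedFracIntegral h1 ha hgL] at hJL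
  have hfin : laplaceTransform (temperedRLDeriv β lam g) s =
      (Real.Gamma (1 - β))⁻¹ * laplaceTransform (deriv J) (s + lam) -
        lam ^ β * laplaceTransform g s := by
    simp only [laplaceTransform]
    rw [← integral_const_mul, ← integral_const_mul,
      ← integral_sub (hJ'.const_mul _) (hgL.const_mul _)]
    exact integral_congr_ae (.of_forall hpt)
  rw [hfin, hJL, temperedSymbol, Real.rpow_sub_one ha.ne']
  field_simp

end FractionalIntegral

/-! ### Uniqueness for functions and continuity of fractional integrals -/

theorem withDensity_restrict_Ioi_apply_Iio (u : ℝ → ℝ≥0∞) :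
    ((volume.restrict (Ioi (0 : ℝ))).withDensity u) (Iio 0) = 0 := by
  refine withDensity_absolutelyContinuous _ _ ?_
  rw [Measure.restrict_apply measurableSet_Iio]
  have : Iio (0 : ℝ) ∩ Ioi 0 = ∅ := by
    ext t; simpa using fun h : t < 0 => h.le
  simp [this]

/-- Two nonnegative functions on the half line with the same Laplace transform agree almost
everywhere. -/
theorem ae_eq_of_laplaceTransform_eq {f g : ℝ → ℝ} (hf : IntegrableOn f (Ioi 0))
    (hg : IntegrableOn g (Ioi 0)) (hf0 : ∀ t, 0 < t → 0 ≤ f t) (hg0 : ∀ t, 0 < t → 0 ≤ g t)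
    (h : ∀ s, 0 < s → laplaceTransform f s = laplaceTransform g s) :
    f =ᵐ[volume.restrict (Ioi 0)] g := by
  have hfin : ∀ {u : ℝ → ℝ}, IntegrableOn u (Ioi 0) → IsFiniteMeasure
      ((volume.restrict (Ioi (0 : ℝ))).withDensity fun t => ENNReal.ofReal (u t)) :=
    fun hu => isFiniteMeasure_withDensity_ofReal hu.2
  have hlap : ∀ {u : ℝ → ℝ}, IntegrableOn u (Ioi 0) → (∀ t, 0 < t → 0 ≤ u t) → ∀ s,
      ∫ t, Real.exp (-s * t) ∂((volume.restrict (Ioi (0 : ℝ))).withDensity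
        fun t => ENNReal.ofReal (u t)) = laplaceTransform u s := by
    intro u hu hu0 s
    rw [integral_withDensity_eq_integral_toReal_smul₀ hu.1.aemeasurable.ennreal_ofReal
      (.of_forall fun _ => ENNReal.ofReal_lt_top), laplaceTransform]
    refine setIntegral_congr_fun measurableSet_Ioi fun t ht => ?_
    simp only [smul_eq_mul]
    rw [ENNReal.toReal_ofReal (hu0 t ht), mul_comm]
  have := hfin hf
  have := hfin hg
  have heq := Measure.ext_of_laplace (withDensity_restrict_Ioi_apply_Iio fun t => ENNReal.ofReal (f t))
    (withDensity_restrict_Ioi_apply_Iio fun t => ENNReal.ofReal (g t))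
    fun s hs => by rw [hlap hf hf0, hlap hg hg0, h s hs]
  rw [withDensity_eq_iff hf.1.aemeasurable.ennreal_ofReal hg.1.aemeasurable.ennreal_ofReal
    hf.lintegral_lt_top.ne] at heq
  filter_upwards [heq, self_mem_ae_restrict measurableSet_Ioi] with t ht ht0
  exact (ENNReal.ofReal_eq_ofReal_iff (hf0 t ht0) (hg0 t ht0)).1 ht

/-- Replacing r by t - r moves t out of the singular kernel. Since h vanishes on the nonpositive
axis, the range can be fixed as (0, T], and dominated convergence applies. -/
theorem continuousOn_integral_div_rpow {β : ℝ} (h1 : β < 1) {h : ℝ → ℝ} (hc : Continuous h)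
    (h0 : ∀ t ≤ 0, h t = 0) :
    ContinuousOn (fun t => ∫ r in (0 : ℝ)..t, h r / (t - r) ^ β) (Ioi 0) := by
  intro t₀ ht₀
  set T : ℝ := t₀ + 1 with hT
  have ht₀' : 0 < t₀ := ht₀
  obtain ⟨C, hC⟩ := (isCompact_Icc (a := (0 : ℝ)) (b := T)).exists_bound_of_continuousOn
    hc.continuousOn
  have hbd : ∀ t ≤ T, ‖h t‖ ≤ max C 0 := fun t ht => by
    rcases le_or_gt t 0 with h | h
    · simp [h0 t h]
    · exact (hC t ⟨h.le, ht⟩).trans (le_max_left _ _)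
  have hk : IntegrableOn (fun r : ℝ => r ^ (-β)) (Ioc 0 T) :=
    (intervalIntegral.intervalIntegrable_rpow' (a := 0) (b := T) (by linarith : -1 < -β)).1
  have hcont : ContinuousOn (fun t => ∫ r in Ioc 0 T, h (t - r) * r ^ (-β)) (Iio T) := by
    refine continuousOn_of_dominated (bound := fun r => max C 0 * r ^ (-β)) ?_ ?_
      (hk.const_mul _) (.of_forall fun r => by fun_prop)
    · exact fun t _ => Measurable.aestronglyMeasurable
        ((hc.measurable.comp (measurable_const.sub measurable_id)).mul (by fun_prop))
    · intro t ht
      filter_upwards [self_mem_ae_restrict measurableSet_Ioc] with r hr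
      have hr0 : 0 < r := hr.1
      have ht' : t < T := ht
      rw [norm_mul, Real.norm_of_nonneg (Real.rpow_nonneg hr0.le _)]
      gcongr
      exact hbd _ (by linarith)
  refine ContinuousAt.continuousWithinAt ?_
  refine (hcont.continuousAt (Iio_mem_nhds (by simp [hT]))).congr ?_
  filter_upwards [Ioo_mem_nhds ht₀' (show t₀ < T by simp [hT])] with t ht
  have e1 : ∫ r in (0 : ℝ)..t, h r / (t - r) ^ β = ∫ r in (0 : ℝ)..t, h (t - r) / r ^ β := by
    have := intervalIntegral.integral_comp_sub_left (fun r => h (t - r) / r ^ β) t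
      (a := 0) (b := t)
    simpa using this
  rw [e1, intervalIntegral.integral_of_le ht.1.le]
  rw [← setIntegral_eq_of_subset_of_forall_sdiff_eq_zero (s := Ioc 0 t) (t := Ioc 0 T)
    measurableSet_Ioc (Ioc_subset_Ioc_right ht.2.le)]
  · refine setIntegral_congr_fun measurableSet_Ioc fun r hr => ?_
    rw [Real.rpow_neg hr.1.le, div_eq_mul_inv]
  · intro r hr
    have : t < r := by
      by_contra hle
      exact hr.2 ⟨hr.1.1, not_lt.1 hle⟩
    rw [h0 _ (by linarith), zero_div]

theorem integrableOn_exp_neg_mul {s : ℝ} (hs : 0 < s) :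
    IntegrableOn (fun t : ℝ => Real.exp (-s * t)) (Ioi 0) := by
  simpa using integrableOn_rpow_mul_exp_neg_mul_rpow (p := 1) (s := 0) (b := s)
    (by norm_num) one_pos hs

theorem integrableOn_mul_exp_neg_mul {s : ℝ} (hs : 0 < s) :
    IntegrableOn (fun t : ℝ => t * Real.exp (-s * t)) (Ioi 0) := by
  simpa using integrableOn_rpow_mul_exp_neg_mul_rpow (p := 1) (s := 1) (b := s)
    (by norm_num) one_pos hs

/-! ### The fractional integral of a tempered stable density -/

section TemperedLaw

variable {β lam x C : ℝ} {p p' : ℝ → ℝ}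

theorem hasLaplaceTransform_of_bounded (hpc : Continuous p) (hpC : ∀ t, |p t| ≤ C) {s : ℝ}
    (hs : 0 < s) : HasLaplaceTransform p s :=
  (integrableOn_exp_neg_mul hs).mul_bdd (c := C) hpc.aestronglyMeasurable (.of_forall hpC)

theorem hasLaplaceTransform_mul_of_bounded (hpc : Continuous p) (hpC : ∀ t, |p t| ≤ C) {s : ℝ}
    (hs : 0 < s) : HasLaplaceTransform (fun t => t * p t) s :=
  ((integrableOn_mul_exp_neg_mul hs).mul_bdd (c := C) hpc.aestronglyMeasurable (.of_forall hpC)).congr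
    (.of_forall fun t => by ring)

theorem hasDerivAt_laplaceTransform (hpc : Continuous p) (hpC : ∀ t, |p t| ≤ C) {s : ℝ}
    (hs : 0 < s) :
    HasDerivAt (laplaceTransform p) (-laplaceTransform (fun t => t * p t) s) s := by
  -- On the neighbourhood z > s/2 of s the derivative is dominated by its bound at s/2.
  have hb : IntegrableOn (fun t : ℝ => t * Real.exp (-(s / 2) * t) * C) (Ioi 0) :=
    (integrableOn_mul_exp_neg_mul (half_pos hs)).mul_const C
  have h := hasDerivAt_integral_of_dominated_loc_of_deriv_le
    (μ := volume.restrict (Ioi (0 : ℝ))) (x₀ := s) (s := Ioi (s / 2))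
    (F := fun s t => Real.exp (-s * t) * p t) (F' := fun s t => -(Real.exp (-s * t) * (t * p t)))
    (bound := fun t => t * Real.exp (-(s / 2) * t) * C) (Ioi_mem_nhds (half_lt_self hs))
    (.of_forall fun s => by fun_prop) (hasLaplaceTransform_of_bounded hpc hpC hs) (by fun_prop)
    ?_ hb (.of_forall fun t z _ => ?_)
  · have h2 := h.2
    rw [integral_neg] at h2
    exact h2
  · filter_upwards [self_mem_ae_restrict measurableSet_Ioi] with t ht z hz
    have ht0 : 0 < t := ht
    have hz' : s / 2 < z := hz
    rw [norm_neg, norm_mul, norm_mul, Real.norm_of_nonneg (Real.exp_pos _).le,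
      Real.norm_of_nonneg ht0.le]
    calc _ = t * Real.exp (-z * t) * ‖p t‖ := by ring
      _ ≤ _ := by
        refine mul_le_mul ?_ (hpC t) (abs_nonneg _) (by positivity)
        gcongr
  · have := (((hasDerivAt_neg z).mul_const t).exp).mul_const (p t)
    convert! this using 1
    ring

/-- The infinitesimal form of the Laplace exponent: `t p(t)` is a multiple of the tempered
fractional integral of the density `p`. -/
theorem temperedFracIntegral_eq_of_laplace (h0 : 0 < β) (h1 : β < 1) (hlam : 0 ≤ lam)
    (hx : 0 < x) (hpc : Continuous p) (hp0 : ∀ t, 0 ≤ p t) (hpC : ∀ t, |p t| ≤ C)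
    (hpz : ∀ t ≤ 0, p t = 0)
    (hL : ∀ s, 0 < s → laplaceTransform p s = Real.exp (-x * temperedSymbol β lam s)) {t : ℝ}
    (ht : 0 < t) :
    temperedFracIntegral β lam p t =
      Real.exp (lam * t) * (Real.Gamma (1 - β) / (x * β) * (t * p t)) := by
  have hG : 0 < Real.Gamma (1 - β) := Real.Gamma_pos_of_pos (by linarith)
  -- Both sides of `hL` are differentiated in s.
  have hderiv : ∀ s, 0 < s → laplaceTransform (fun t => t * p t) s =
      x * β * (s + lam) ^ (β - 1) * laplaceTransform p s := by
    intro s hs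
    have hd1 := hasDerivAt_laplaceTransform hpc hpC hs
    have hsl : s + lam ≠ 0 := by positivity
    have hd2 : HasDerivAt (fun s => Real.exp (-x * temperedSymbol β lam s))
        (Real.exp (-x * temperedSymbol β lam s) * (-x * (β * (s + lam) ^ (β - 1)))) s := by
      have := ((((hasDerivAt_id s).add_const lam).rpow_const (p := β) (Or.inl hsl)).sub_const
        (lam ^ β)).const_mul (-x) |>.exp
      simpa [temperedSymbol] using this
    have hd3 := hd1.congr_of_eventuallyEq (f₁ := fun s => Real.exp (-x * temperedSymbol β lam s)) (by
      filter_upwards [lt_mem_nhds hs] with s hs using (hL s hs).symm)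
    have := hd3.unique hd2
    rw [hL s hs]
    linarith
  -- The extra factor e^(-t) makes both sides integrable: for λ = 0 the function t p(t) is not, the
  -- stable law having infinite mean. It shifts the transforms to s + 1.
  set A : ℝ → ℝ := fun t => Real.exp (-(1 + lam) * t) * temperedFracIntegral β lam p t with hA
  set B : ℝ → ℝ := fun t => Real.Gamma (1 - β) / (x * β) * (Real.exp (-1 * t) * (t * p t)) with hB
  have hAi : IntegrableOn A (Ioi 0) := hasLaplaceTransform_temperedFracIntegral h1 (by positivity)
    (hasLaplaceTransform_of_bounded hpc hpC one_pos)
  have hBi : IntegrableOn B (Ioi 0) :=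
    (hasLaplaceTransform_mul_of_bounded hpc hpC one_pos).const_mul _
  have hA0 : ∀ t, 0 < t → 0 ≤ A t := fun t ht => by
    refine mul_nonneg (Real.exp_pos _).le (intervalIntegral.integral_nonneg ht.le fun r hr => ?_)
    have := Real.rpow_nonneg (sub_nonneg.2 hr.2) β
    have := hp0 r
    positivity
  have hB0 : ∀ t, 0 < t → 0 ≤ B t := fun t ht => by
    have := hp0 t
    positivity
  have hlap : ∀ s, 0 < s → laplaceTransform A s = laplaceTransform B s := by
    intro s hs
    have hs1 : 0 < s + 1 := by positivity
    have eA : laplaceTransform A s =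
        laplaceTransform (temperedFracIntegral β lam p) (s + 1 + lam) := by
      refine integral_congr_ae (.of_forall fun t => ?_)
      simp only [hA, ← mul_assoc, ← Real.exp_add]
      ring_nf
    have eB : laplaceTransform B s =
        Real.Gamma (1 - β) / (x * β) * laplaceTransform (fun t => t * p t) (s + 1) := by
      simp only [laplaceTransform]
      rw [← integral_const_mul]
      refine integral_congr_ae (.of_forall fun t => ?_)
      simp only [hB]
      rw [show -(s + 1) * t = -s * t + -1 * t by ring, Real.exp_add]
      ring
    rw [eA, eB, laplaceTransform_temperedFracIntegral h1 (by positivity)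
      (hasLaplaceTransform_of_bounded hpc hpC hs1), hderiv _ hs1]
    field_simp
  have hJc : ContinuousOn (temperedFracIntegral β lam p) (Ioi 0) :=
    continuousOn_integral_div_rpow h1 (h := fun r => Real.exp (lam * r) * p r) (by fun_prop)
      fun t ht => by simp [hpz t ht]
  -- Continuity upgrades almost everywhere equality to equality at every t > 0.
  have heq : EqOn A B (Ioi 0) := Measure.eqOn_open_of_ae_eq
    (ae_eq_of_laplaceTransform_eq hAi hBi hA0 hB0 hlap) isOpen_Ioi
    (ContinuousOn.mul (by fun_prop) hJc) (by fun_prop)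
  have h := heq ht
  simp only [hA, hB] at h
  have hexp : Real.exp ((1 + lam) * t) * Real.exp (-(1 + lam) * t) = 1 := by
    rw [← Real.exp_add, Real.exp_eq_one_iff]; ring
  have hexp' : Real.exp ((1 + lam) * t) * Real.exp (-1 * t) = Real.exp (lam * t) := by
    rw [← Real.exp_add]; congr 1; ring
  calc _ = Real.exp ((1 + lam) * t) *
        (Real.exp (-(1 + lam) * t) * temperedFracIntegral β lam p t) := by
        rw [← mul_assoc, hexp, one_mul]
    _ = _ := by rw [h, ← hexp']; ring

theorem temperedFracIntegral_congr_ae {g h : ℝ → ℝ} (hgh : g =ᵐ[volume.restrict (Ioi 0)] h)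
    {t : ℝ} (ht : 0 ≤ t) : temperedFracIntegral β lam g t = temperedFracIntegral β lam h t := by
  rw [ae_eq_comm, Filter.EventuallyEq, ae_restrict_iff' measurableSet_Ioi] at hgh
  refine intervalIntegral.integral_congr_ae ?_
  filter_upwards [hgh] with r hr hrt
  rw [uIoc_of_le ht] at hrt
  rw [hr hrt.1]

/-- A function that agrees almost everywhere with a `C¹` density of the tempered stable law is
in the domain of the tempered derivative, and its derivative has a Laplace transform. -/
theorem temperedRLDifferentiable_of_density (h0 : 0 < β) (h1 : β < 1) (hlam : 0 ≤ lam)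
    (hx : 0 < x) (hpd : ∀ t, HasDerivAt p (p' t) t) (hp'c : Continuous p') (hp0 : ∀ t, 0 ≤ p t)
    (hpC : ∀ t, |p t| ≤ C) (hpC' : ∀ t, |p' t| ≤ C) (hpz : ∀ t ≤ 0, p t = 0)
    (hL : ∀ s, 0 < s → laplaceTransform p s = Real.exp (-x * temperedSymbol β lam s))
    {g : ℝ → ℝ} (hg : g =ᵐ[volume.restrict (Ioi 0)] p) :
    TemperedRLDifferentiable β lam g ∧
      ∀ s, 0 < s → HasLaplaceTransform (temperedRLDeriv β lam g) s := by
  have hG : 0 < Real.Gamma (1 - β) := Real.Gamma_pos_of_pos (by linarith)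
  have hpc : Continuous p := continuous_iff_continuousAt.2 fun t => (hpd t).continuousAt
  set c : ℝ := Real.Gamma (1 - β) / (x * β) with hcdef
  set H : ℝ → ℝ := fun t => Real.exp (lam * t) * (c * (t * p t)) with hH
  set H' : ℝ → ℝ := fun t => Real.exp (lam * t) * (c * (lam * (t * p t) + p t + t * p' t)) with hH'
  have hJ : ∀ t, 0 ≤ t → temperedFracIntegral β lam g t = H t := by
    intro t ht
    rw [temperedFracIntegral_congr_ae hg ht]
    rcases ht.eq_or_lt with rfl | ht
    · simp [temperedFracIntegral, hH]
    · exact temperedFracIntegral_eq_of_laplace h0 h1 hlam hx hpc hp0 hpC hpz hL ht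
  have hHd : ∀ t, HasDerivAt H (H' t) t := fun t => by
    have := ((hasDerivAt_id t).const_mul lam).exp.mul
      (((hasDerivAt_id t).mul (hpd t)).const_mul c)
    convert! this using 1
    simp [hH']
    ring
  have hHC : ContDiff ℝ 1 H := by
    rw [contDiff_one_iff_deriv]
    refine ⟨fun t => (hHd t).differentiableAt, ?_⟩
    rw [show deriv H = H' from funext fun t => (hHd t).deriv]
    fun_prop
  refine ⟨⟨fun t ht => ?_, fun T hT => ?_⟩, fun s hs => ?_⟩
  · have hk : IntervalIntegrable (fun r : ℝ => (t - r) ^ (-β)) volume 0 t := by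
      have := (intervalIntegral.intervalIntegrable_rpow' (a := t) (b := 0)
        (by linarith : -1 < -β)).comp_sub_left t
      simpa using this
    have hi : IntervalIntegrable (fun r => Real.exp (lam * r) * p r * (t - r) ^ (-β)) volume 0 t :=
      hk.continuousOn_mul (by fun_prop)
    refine hi.congr_ae ?_
    rw [uIoc_of_le ht.le]
    filter_upwards [ae_restrict_of_ae_restrict_of_subset Ioc_subset_Ioi_self hg,
      self_mem_ae_restrict measurableSet_Ioc] with r hr hrt
    rw [hr, Real.rpow_neg (sub_nonneg.2 hrt.2), div_eq_mul_inv]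
  · refine (hHC.contDiffOn.congr fun t ht => hJ t ?_).absolutelyContinuousOnInterval
    rw [uIcc_of_le hT.le] at ht
    exact ht.1
  -- The factor e^(-λt) of the tempered derivative cancels the e^(λt) in H', leaving a combination
  -- of p, t p and t p'.
  · have hi : HasLaplaceTransform (fun t => (Real.Gamma (1 - β))⁻¹ * c *
        (lam * (t * p t) + p t + t * p' t) - lam ^ β * p t) s := by
      have i1 := hasLaplaceTransform_of_bounded hpc hpC hs
      have i2 := hasLaplaceTransform_mul_of_bounded hpc hpC hs
      have i3 := hasLaplaceTransform_mul_of_bounded hp'c hpC' hs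
      refine (((((i2.const_mul lam).add i1).add i3).const_mul ((Real.Gamma (1 - β))⁻¹ * c)).sub
        (i1.const_mul (lam ^ β))).congr (.of_forall fun t => ?_)
      simp only [Pi.add_apply, Pi.sub_apply]
      ring
    refine Integrable.congr hi ?_
    filter_upwards [hg, self_mem_ae_restrict measurableSet_Ioi] with t ht ht0
    have hd : deriv (temperedFracIntegral β lam g) t = H' t := by
      have : temperedFracIntegral β lam g =ᶠ[𝓝 t] H := by
        filter_upwards [lt_mem_nhds (mem_Ioi.1 ht0)] with r hr using hJ r hr.le
      rw [this.deriv_eq, (hHd t).deriv]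
    have hexp : Real.exp (-lam * t) * Real.exp (lam * t) = 1 := by
      rw [← Real.exp_add]; simp
    rw [temperedRLDeriv, hd, ht]
    simp only [hH']
    linear_combination (-(Real.exp (-s * t) * (1 / Real.Gamma (1 - β)) *
      (c * (lam * (t * p t) + p t + t * p' t)))) * hexp

end TemperedLaw

/-! ### From Laplace transforms of densities to mild solutions -/

theorem IsDensityOnPos.measure_Iio_zero {q : ℝ → ℝ} {μ : Measure ℝ} (h : IsDensityOnPos q μ) :
    μ (Iio 0) = 0 := by
  rw [h.eq_withDensity]
  exact withDensity_restrict_Ioi_apply_Iio _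

theorem IsDensityOnPos.laplaceTransform_eq {q : ℝ → ℝ} {μ : Measure ℝ} (h : IsDensityOnPos q μ)
    (s : ℝ) : laplaceTransform q s = ∫ t, Real.exp (-s * t) ∂μ := by
  rw [h.eq_withDensity, integral_withDensity_eq_integral_toReal_smul
    h.measurable.ennreal_ofReal (.of_forall fun _ => ENNReal.ofReal_lt_top), laplaceTransform]
  refine setIntegral_congr_fun measurableSet_Ioi fun t ht => ?_
  simp only [smul_eq_mul]
  rw [ENNReal.toReal_ofReal (h.nonneg t ht), mul_comm]

theorem withDensity_eq_restrict_Ioi {p : ℝ → ℝ} (hpz : ∀ t ≤ 0, p t = 0) :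
    volume.withDensity (fun t => ENNReal.ofReal (p t)) =
      (volume.restrict (Ioi (0 : ℝ))).withDensity (fun t => ENNReal.ofReal (p t)) := by
  rw [← withDensity_indicator measurableSet_Ioi]
  congr 1
  ext t
  by_cases ht : 0 < t
  · rw [indicator_of_mem (mem_Ioi.2 ht)]
  · rw [indicator_of_notMem (by simpa using ht), hpz t (not_lt.1 ht), ENNReal.ofReal_zero]

/-- Densities of laws with the Laplace transforms of the tempered stable subordinator form a mild
solution. -/
theorem isMildSolution_of_isDensityOnPos {β lam : ℝ} (h0 : 0 < β) (h1 : β < 1) (hlam : 0 ≤ lam)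
    {q : ℝ → ℝ → ℝ} {μ : ℝ → Measure ℝ} [∀ x, IsFiniteMeasure (μ x)]
    (hq : ∀ x, 0 < x → IsDensityOnPos (fun t => q t x) (μ x))
    (hL : ∀ x, 0 < x → ∀ s, 0 < s →
      ∫ t, Real.exp (-s * t) ∂(μ x) = Real.exp (-x * temperedSymbol β lam s)) :
    IsMildSolution β lam q := by
  intro x hx
  obtain ⟨p, p', C, hpd, hp'c, hp0, hpC, hpC', hpz, hpμ⟩ :=
    exists_density_of_laplace_temperedSymbol (hq x hx).measure_Iio_zero h0 h1 hlam hx (hL x hx)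
  have hpc : Continuous p := continuous_iff_continuousAt.2 fun t => (hpd t).continuousAt
  rw [withDensity_eq_restrict_Ioi hpz] at hpμ
  have hpd' : IsDensityOnPos p (μ x) := ⟨hpc.measurable, fun t _ => hp0 t, hpμ⟩
  have hLp : ∀ s, 0 < s → laplaceTransform p s = Real.exp (-x * temperedSymbol β lam s) :=
    fun s hs => by rw [hpd'.laplaceTransform_eq, hL x hx s hs]
  have hgp : (fun t => q t x) =ᵐ[volume.restrict (Ioi 0)] p := by
    have heq := (hq x hx).eq_withDensity.symm.trans hpμ
    rw [withDensity_eq_iff_of_sigmaFinite (hq x hx).measurable.ennreal_ofReal.aemeasurable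
      hpc.measurable.ennreal_ofReal.aemeasurable] at heq
    filter_upwards [heq, self_mem_ae_restrict measurableSet_Ioi] with t ht ht0
    exact (ENNReal.ofReal_eq_ofReal_iff ((hq x hx).nonneg t ht0) (hp0 t)).1 ht
  obtain ⟨hdom, hdL⟩ := temperedRLDifferentiable_of_density h0 h1 hlam hx hpd hp'c hp0 hpC hpC' hpz
    hLp hgp
  refine ⟨hdom, fun s hs => ?_⟩
  have hqL : HasLaplaceTransform (fun t => q t x) s := by
    refine Integrable.congr (hasLaplaceTransform_of_bounded hpc hpC hs) ?_
    filter_upwards [hgp] with t ht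
    rw [ht]
  refine ⟨hqL, hdL s hs, ?_⟩
  -- Both sides of the transformed equation become -ψ e^(-xψ).
  rw [isLaplaceSymbolOfTemperedRLDeriv h1 hlam _ s hs hdom hqL (hdL s hs),
    (hq x hx).laplaceTransform_eq, hL x hx s hs]
  have hd : HasDerivAt (fun x' => Real.exp (-x' * temperedSymbol β lam s))
      (-(temperedSymbol β lam s * Real.exp (-x * temperedSymbol β lam s))) x := by
    convert! ((hasDerivAt_neg x).mul_const (temperedSymbol β lam s)).exp using 1
    ring
  refine hd.congr_of_eventuallyEq ?_
  filter_upwards [lt_mem_nhds hx] with y hy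
  rw [(hq y hy).laplaceTransform_eq, hL y hy s hs]

/-! ### Subordinators and the proposition -/

section Subordinator

variable {Ω : Type*} [MeasurableSpace Ω] {P : Measure Ω} {D : ℝ≥0 → Ω → ℝ} {ν : Measure ℝ}

theorem IsSubordinator.map_Iio_zero (h : IsSubordinator D P ν) (x : ℝ≥0) :
    P.map (D x) (Iio 0) = 0 := by
  rw [Measure.map_apply (h.measurable x) measurableSet_Iio]
  have : ∀ᵐ ω ∂P, ¬ D x ω < 0 := by
    filter_upwards [h.zero, h.paths] with ω hω hp
    rw [not_lt, ← hω]
    exact hp.1 zero_le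
  simp only [ae_iff, not_not] at this
  exact this

theorem IsSubordinator.integral_exp_map (h : IsSubordinator D P ν) (x : ℝ≥0) {s : ℝ}
    (hs : 0 ≤ s) : ∫ t, Real.exp (-s * t) ∂(P.map (D x)) =
      Real.exp (-(x : ℝ) * ∫ y, (1 - Real.exp (-s * y)) ∂ν) := by
  rw [integral_map (h.measurable x).aemeasurable (by fun_prop), h.laplace x s hs]

end Subordinator

theorem laplaceTransform_temperedDensity (β lam : ℝ) (f : ℝ → ℝ → ℝ) (x s : ℝ) :
    laplaceTransform (fun t => temperedDensity β lam f t x) s =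
      Real.exp (x * lam ^ β) * laplaceTransform (fun t => f t x) (s + lam) := by
  simp only [laplaceTransform]
  rw [← integral_const_mul]
  refine integral_congr_ae (.of_forall fun t => ?_)
  simp only [temperedDensity]
  rw [div_eq_mul_inv, ← Real.exp_neg, show -(s + lam) * t = -s * t + -lam * t by ring,
    Real.exp_add, neg_mul x, neg_neg]
  ring

/-- The measure with density `q` on the positive half line. -/
noncomputable def posDensityMeasure (q : ℝ → ℝ) : Measure ℝ :=
  (volume.restrict (Ioi (0 : ℝ))).withDensity fun t => ENNReal.ofReal (q t)

theorem proposition3p1 {Ω : Type*} [MeasurableSpace Ω] (P : Measure Ω) [IsProbabilityMeasure P]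
    {Ω' : Type*} [MeasurableSpace Ω'] (P' : Measure Ω') [IsProbabilityMeasure P']
    (β lam : ℝ) (hβ0 : 0 < β) (hβ1 : β < 1) (hlam : 0 ≤ lam) :
    -- the Laplace symbol of the tempered fractional derivative
    IsLaplaceSymbolOfTemperedRLDeriv β lam (temperedSymbol β lam) ∧
    -- the tempered stable subordinator has densities, and they form a mild solution
    (∀ D : ℝ≥0 → Ω → ℝ, IsSubordinator D P (temperedStableLevyMeasure β lam) →
      (∃ q : ℝ → ℝ → ℝ,
        ∀ x : ℝ≥0, 0 < x → IsDensityOnPos (fun t => q t x) (P.map (D x))) ∧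
      ∀ q : ℝ → ℝ → ℝ,
        (∀ x : ℝ≥0, 0 < x → IsDensityOnPos (fun t => q t x) (P.map (D x))) →
        IsMildSolution β lam q) ∧
    -- the tilted stable densities are such densities
    (∀ S : ℝ≥0 → Ω' → ℝ, IsSubordinator S P' (stableLevyMeasure β) →
      ∀ f : ℝ → ℝ → ℝ,
        (∀ x : ℝ≥0, 0 < x → IsDensityOnPos (fun t => f t x) (P'.map (S x))) →
        IsMildSolution β lam (temperedDensity β lam f) ∧
        ∀ D : ℝ≥0 → Ω → ℝ, IsSubordinator D P (temperedStableLevyMeasure β lam) →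
          ∀ x : ℝ≥0, 0 < x →
            IsDensityOnPos (fun t => temperedDensity β lam f t x) (P.map (D x))) := by
  have hLD : ∀ D : ℝ≥0 → Ω → ℝ, IsSubordinator D P (temperedStableLevyMeasure β lam) →
      ∀ (x : ℝ≥0) (s : ℝ), 0 < s → ∫ t, Real.exp (-s * t) ∂(P.map (D x)) =
        Real.exp (-(x : ℝ) * temperedSymbol β lam s) := fun D hD x s hs => by
    rw [hD.integral_exp_map x hs.le,
      integral_one_sub_exp_temperedStableLevyMeasure hβ0 hβ1 hlam hs.le]
  refine ⟨isLaplaceSymbolOfTemperedRLDeriv hβ1 hlam, fun D hD => ⟨?_, fun q hq => ?_⟩,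
    fun S hS f hf => ?_⟩
  · have hex : ∀ x : ℝ, ∃ p : ℝ → ℝ, 0 < x → IsDensityOnPos p (P.map (D x.toNNReal)) := by
      intro x
      by_cases hx : 0 < x
      · have hL := hLD D hD x.toNNReal
        rw [Real.coe_toNNReal x hx.le] at hL
        obtain ⟨p, p', C, hpd, -, hp0, -, -, hpz, hpμ⟩ :=
          exists_density_of_laplace_temperedSymbol (hD.map_Iio_zero x.toNNReal) hβ0 hβ1 hlam hx hL
        have hpc : Continuous p := continuous_iff_continuousAt.2 fun t => (hpd t).continuousAt
        exact ⟨p, fun _ => ⟨hpc.measurable, fun t _ => hp0 t,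
          by rw [← withDensity_eq_restrict_Ioi hpz, hpμ]⟩⟩
      · exact ⟨0, fun h => absurd h hx⟩
    choose p hp using hex
    refine ⟨fun t x => p x t, fun x hx => ?_⟩
    simpa using hp x (by exact_mod_cast hx)
  · refine isMildSolution_of_isDensityOnPos hβ0 hβ1 hlam (μ := fun x => P.map (D x.toNNReal))
      (fun x hx => ?_) fun x hx s hs => ?_
    · simpa [hx.le] using hq x.toNNReal (by simpa using hx)
    · rw [hLD D hD _ s hs, Real.coe_toNNReal x hx.le]
  · have hLS : ∀ x : ℝ, 0 < x → ∀ s, 0 ≤ s →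
        laplaceTransform (fun t => f t x) s = Real.exp (-x * s ^ β) := fun x hx s hs => by
      have hd := hf x.toNNReal (by simpa using hx)
      rw [Real.coe_toNNReal x hx.le] at hd
      rw [hd.laplaceTransform_eq, hS.integral_exp_map _ hs,
        integral_one_sub_exp_stableLevyMeasure hβ0 hβ1 hs, Real.coe_toNNReal x hx.le]
    have hmeas : ∀ x : ℝ, 0 < x → Measurable fun t => f t x := fun x hx => by
      simpa [hx.le] using (hf x.toNNReal (by simpa using hx)).measurable
    have hnn : ∀ x : ℝ, 0 < x → ∀ t, 0 < t → 0 ≤ f t x := fun x hx => by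
      simpa [hx.le] using (hf x.toNNReal (by simpa using hx)).nonneg
    -- The tilted family is studied through the measures it defines itself, so its mild equation
    -- presupposes no tempered subordinator.
    have hdens : ∀ x : ℝ, 0 < x → IsDensityOnPos (fun t => temperedDensity β lam f t x)
        (posDensityMeasure fun t => temperedDensity β lam f t x) := fun x hx => by
      refine ⟨?_, fun t ht => ?_, rfl⟩
      · have := hmeas x hx
        unfold temperedDensity
        fun_prop
      · have := hnn x hx t ht
        unfold temperedDensity
        positivity
    have hLT : ∀ x : ℝ, 0 < x → ∀ s, 0 ≤ s →
        ∫ t, Real.exp (-s * t) ∂(posDensityMeasure fun t => temperedDensity β lam f t x) =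
          Real.exp (-x * temperedSymbol β lam s) := fun x hx s hs => by
      rw [← (hdens x hx).laplaceTransform_eq, laplaceTransform_temperedDensity,
        hLS x hx _ (by positivity), ← Real.exp_add, temperedSymbol]
      ring_nf
    have hprob : ∀ x : ℝ, 0 < x →
        IsFiniteMeasure (posDensityMeasure fun t => temperedDensity β lam f t x) := fun x hx => by
      have h := hLT x hx 0 le_rfl
      have hi : Integrable (fun _ => (1 : ℝ))
          (posDensityMeasure fun t => temperedDensity β lam f t x) := by
        -- The transform at s = 0 is an exponential, hence nonzero, whereas the integral of a
        -- nonintegrable function is 0 by convention.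
        by_contra hni
        have h' : ∫ _, (1 : ℝ) ∂(posDensityMeasure fun t => temperedDensity β lam f t x) = 0 :=
          integral_undef hni
        simp only [neg_zero, zero_mul, Real.exp_zero] at h
        rw [h'] at h
        exact (Real.exp_pos _).ne h
      exact (integrable_const_iff_isFiniteMeasure one_ne_zero).1 hi
    refine ⟨?_, fun D hD x hx => ?_⟩
    -- A finite measure is needed at every real x; the zero measure fills in x ≤ 0.
    · have : ∀ x : ℝ, IsFiniteMeasure (if 0 < x then
          posDensityMeasure fun t => temperedDensity β lam f t x else 0) := fun x => by
        split_ifs with hx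
        · exact hprob x hx
        · infer_instance
      refine isMildSolution_of_isDensityOnPos hβ0 hβ1 hlam (μ := fun x => if 0 < x then
          posDensityMeasure fun t => temperedDensity β lam f t x else 0)
        (fun x hx => ?_) fun x hx s hs => ?_
      · simpa [hx] using hdens x hx
      · simpa only [hx, if_true] using hLT x hx s hs.le
    · have hx' : (0 : ℝ) < x := by exact_mod_cast hx
      have := hprob x hx'
      have heq : P.map (D x) = posDensityMeasure fun t => temperedDensity β lam f t x :=
        Measure.ext_of_laplace (hD.map_Iio_zero x) (hdens x hx').measure_Iio_zero fun s hs => by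
          rw [hLD D hD x s hs, hLT x hx' s hs.le]
      rw [heq]
      exact hdens x hx'
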